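/- All games are short partizan combinatorial game forms: a form is given by finitely many Left options and finitely many Right options, which are themselves forms of the same kind. Games are played under the misère convention (a player who is to move and has no move wins), and $G+H$ denotes the disjunctive sum. Write $G=H$ if, for every short game $X$, the games $G+X$ and $H+X$ have the same misère outcome (i.e. for either choice of the player who moves first, the same player wins). A Left end is a game with no Left option, and a Left dead end is a game all of whose subpositions (including the game itself) are Left ends. Let $\mathcal{L}$ be the commutative monoid of Left dead ends modulo $=$, under disjunctive sum. **Proposition.** If $G$ and $H$ are Left dead ends with $n\cdot G=n\cdot H$ for some integer $n>0$, where $n\cdot G=G+\cdots+G$ ($n$ summands), then $G=H$. Moreover, the Grothendieck group (group of differences) of the monoid $\mathcal{L}$ is torsion-free. -/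

import Mathlib

/-- Short partizan game forms: a form is given by finitely many Left options and finitely many
Right options, each of which is again a short game form. -/
inductive ShortGame : Type
  | mk (m n : ℕ) (L : Fin m → ShortGame) (R : Fin n → ShortGame) : ShortGame

/-- The two players. -/
inductive GamePlayer : Type
  | left
  | right

namespace ShortGame

/-- `IsLeftOption x G`: the form `x` is a Left option of `G`. -/
def IsLeftOption (x : ShortGame) : ShortGame → Prop
  | mk _ _ L _ => ∃ i, L i = x

/-- `IsRightOption x G`: the form `x` is a Right option of `G`. -/
def IsRightOption (x : ShortGame) : ShortGame → Prop
  | mk _ _ _ R => ∃ j, R j = x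

/-- `x` is an option (of either player) of `G`. -/
def IsOption (x G : ShortGame) : Prop := IsLeftOption x G ∨ IsRightOption x G

/-- `x` is a subposition of `G`: it is reached from `G` by a (possibly empty) sequence of moves,
the moves being made by either player in any order. -/
def IsSubposition (x G : ShortGame) : Prop := Relation.ReflTransGen IsOption x G

/-- A Left end is a game with no Left option. -/
def IsLeftEnd (G : ShortGame) : Prop := ∀ x, ¬ IsLeftOption x G

/-- A Left dead end is a game all of whose subpositions (itself included) are Left ends. -/
def IsLeftDeadEnd (G : ShortGame) : Prop := ∀ x, IsSubposition x G → IsLeftEnd x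

/-- The zero game, with no options at all. -/
instance : Zero ShortGame := ⟨mk 0 0 Fin.elim0 Fin.elim0⟩

/-- The disjunctive compound of two games, by recursion on both: a player moves in exactly one of
the two components. -/
noncomputable def add (x : ShortGame) : ShortGame → ShortGame :=
  ShortGame.rec (motive := fun _ => ShortGame → ShortGame)
    (fun m n _L _R addL addR y =>
      ShortGame.rec (motive := fun _ => ShortGame)
        (fun m' n' L' R' addL' addR' =>
          mk (m + m') (n + n')
            (Fin.append (fun i => addL i (mk m' n' L' R')) addL')
            (Fin.append (fun j => addR j (mk m' n' L' R')) addR'))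
        y)
    x

noncomputable instance : Add ShortGame := ⟨add⟩

theorem mk_add_mk (m n : ℕ) (L : Fin m → ShortGame) (R : Fin n → ShortGame)
    (m' n' : ℕ) (L' : Fin m' → ShortGame) (R' : Fin n' → ShortGame) :
    mk m n L R + mk m' n' L' R' =
      mk (m + m') (n + n')
        (Fin.append (fun i => L i + mk m' n' L' R') (fun i => mk m n L R + L' i))
        (Fin.append (fun j => R j + mk m' n' L' R') (fun j => mk m n L R + R' j)) := rfl

/-- The `n`-fold disjunctive sum `n · G = G + ⋯ + G` of a form. -/
noncomputable def copies : ℕ → ShortGame → ShortGame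
  | 0, _ => 0
  | n + 1, G => copies n G + G

/-- `MisereWinsFirst p G`: under misère play (a player who is to move and has no move wins),
player `p` wins `G` when moving first. -/
def MisereWinsFirst : GamePlayer → ShortGame → Prop
  | .left, mk m _ L _ => m = 0 ∨ ∃ i, ¬ MisereWinsFirst .right (L i)
  | .right, mk _ n _ R => n = 0 ∨ ∃ j, ¬ MisereWinsFirst .left (R j)

/-- Two forms have the same misère outcome: for either choice of the player who moves first, the
same player wins. -/
def SameOutcome (G H : ShortGame) : Prop :=
  ∀ p, MisereWinsFirst p G ↔ MisereWinsFirst p H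

/-- Equality of games modulo the full misère universe: `G + X` and `H + X` have the same misère
outcome for every short game `X`. -/
def MisereEq (G H : ShortGame) : Prop := ∀ X : ShortGame, SameOutcome (G + X) (H + X)

/-! Helper facts: disjunctive sum is a commutative monoid operation modulo `MisereEq`. -/

theorem isLeftOption_add {z x y : ShortGame} :
    IsLeftOption z (x + y) ↔
      (∃ x', IsLeftOption x' x ∧ z = x' + y) ∨ (∃ y', IsLeftOption y' y ∧ z = x + y') := by
  obtain ⟨m, n, L, R⟩ := x
  obtain ⟨m', n', L', R'⟩ := y
  rw [mk_add_mk]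
  simp only [IsLeftOption]
  constructor
  · rintro ⟨i, rfl⟩
    induction i using Fin.addCases with
    | left i => exact Or.inl ⟨_, ⟨i, rfl⟩, by simp⟩
    | right i => exact Or.inr ⟨_, ⟨i, rfl⟩, by simp⟩
  · rintro (⟨_, ⟨i, rfl⟩, rfl⟩ | ⟨_, ⟨i, rfl⟩, rfl⟩)
    · exact ⟨Fin.castAdd _ i, by simp⟩
    · exact ⟨Fin.natAdd _ i, by simp⟩

theorem isRightOption_add {z x y : ShortGame} :
    IsRightOption z (x + y) ↔
      (∃ x', IsRightOption x' x ∧ z = x' + y) ∨ (∃ y', IsRightOption y' y ∧ z = x + y') := by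
  obtain ⟨m, n, L, R⟩ := x
  obtain ⟨m', n', L', R'⟩ := y
  rw [mk_add_mk]
  simp only [IsRightOption]
  constructor
  · rintro ⟨i, rfl⟩
    induction i using Fin.addCases with
    | left i => exact Or.inl ⟨_, ⟨i, rfl⟩, by simp⟩
    | right i => exact Or.inr ⟨_, ⟨i, rfl⟩, by simp⟩
  · rintro (⟨_, ⟨i, rfl⟩, rfl⟩ | ⟨_, ⟨i, rfl⟩, rfl⟩)
    · exact ⟨Fin.castAdd _ i, by simp⟩
    · exact ⟨Fin.natAdd _ i, by simp⟩

theorem not_isLeftOption_zero (x : ShortGame) : ¬ IsLeftOption x 0 := fun ⟨i, _⟩ => i.elim0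

theorem not_isRightOption_zero (x : ShortGame) : ¬ IsRightOption x 0 := fun ⟨i, _⟩ => i.elim0

theorem misereWinsFirst_left_iff (G : ShortGame) :
    MisereWinsFirst .left G ↔
      (∀ x, ¬ IsLeftOption x G) ∨ ∃ x, IsLeftOption x G ∧ ¬ MisereWinsFirst .right x := by
  obtain ⟨m, n, L, R⟩ := G
  simp only [MisereWinsFirst, IsLeftOption]
  refine or_congr ⟨?_, fun h => ?_⟩ (by simp)
  · rintro rfl x ⟨i, _⟩
    exact i.elim0
  · by_contra hm
    exact h _ ⟨⟨0, Nat.pos_of_ne_zero hm⟩, rfl⟩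

theorem misereWinsFirst_right_iff (G : ShortGame) :
    MisereWinsFirst .right G ↔
      (∀ x, ¬ IsRightOption x G) ∨ ∃ x, IsRightOption x G ∧ ¬ MisereWinsFirst .left x := by
  obtain ⟨m, n, L, R⟩ := G
  simp only [MisereWinsFirst, IsRightOption]
  refine or_congr ⟨?_, fun h => ?_⟩ (by simp)
  · rintro rfl x ⟨i, _⟩
    exact i.elim0
  · by_contra hm
    exact h _ ⟨⟨0, Nat.pos_of_ne_zero hm⟩, rfl⟩

/-- A relation that matches the Left options and the Right options of related forms. -/
structure IsBisimulation (r : ShortGame → ShortGame → Prop) : Prop where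
  left : ∀ a b, r a b → ∀ a', IsLeftOption a' a → ∃ b', IsLeftOption b' b ∧ r a' b'
  left' : ∀ a b, r a b → ∀ b', IsLeftOption b' b → ∃ a', IsLeftOption a' a ∧ r a' b'
  right : ∀ a b, r a b → ∀ a', IsRightOption a' a → ∃ b', IsRightOption b' b ∧ r a' b'
  right' : ∀ a b, r a b → ∀ b', IsRightOption b' b → ∃ a', IsRightOption a' a ∧ r a' b'

theorem IsBisimulation.sameOutcome {r : ShortGame → ShortGame → Prop} (hr : IsBisimulation r)
    {a b : ShortGame} (hab : r a b) : SameOutcome a b := by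
  induction a generalizing b with
  | mk m n L R ihL ihR =>
    have key : ∀ p : GamePlayer, ∀ (O : ShortGame → ShortGame → Prop) (A : ShortGame)
        (q : GamePlayer),
        (∀ a', O a' A → ∃ b', O b' b ∧ r a' b') → (∀ b', O b' b → ∃ a', O a' A ∧ r a' b') →
        (∀ a', O a' A → ∀ b', r a' b' → SameOutcome a' b') →
        (((∀ x, ¬ O x A) ∨ ∃ x, O x A ∧ ¬ MisereWinsFirst q x) ↔
          ((∀ x, ¬ O x b) ∨ ∃ x, O x b ∧ ¬ MisereWinsFirst q x)) := by
      intro p O A q h1 h2 h3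
      refine or_congr ⟨fun h x hx => ?_, fun h x hx => ?_⟩ ⟨?_, ?_⟩
      · obtain ⟨a', ha', -⟩ := h2 x hx
        exact h a' ha'
      · obtain ⟨b', hb', -⟩ := h1 x hx
        exact h b' hb'
      · rintro ⟨x, hx, hw⟩
        obtain ⟨b', hb', hxb⟩ := h1 x hx
        exact ⟨b', hb', fun hw' => hw ((h3 x hx b' hxb q).2 hw')⟩
      · rintro ⟨x, hx, hw⟩
        obtain ⟨a', ha', hax⟩ := h2 x hx
        exact ⟨a', ha', fun hw' => hw ((h3 a' ha' x hax q).1 hw')⟩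
    intro p
    cases p with
    | left =>
      rw [misereWinsFirst_left_iff, misereWinsFirst_left_iff]
      refine key .left IsLeftOption _ _ (hr.left _ _ hab) (hr.left' _ _ hab) ?_
      rintro _ ⟨i, rfl⟩ b' hb'
      exact ihL i hb'
    | right =>
      rw [misereWinsFirst_right_iff, misereWinsFirst_right_iff]
      refine key .right IsRightOption _ _ (hr.right _ _ hab) (hr.right' _ _ hab) ?_
      rintro _ ⟨i, rfl⟩ b' hb'
      exact ihR i hb'

theorem SameOutcome.symm {G H : ShortGame} (h : SameOutcome G H) : SameOutcome H G :=
  fun p => (h p).symm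

theorem SameOutcome.trans {G H K : ShortGame} (h : SameOutcome G H) (h' : SameOutcome H K) :
    SameOutcome G K := fun p => (h p).trans (h' p)

theorem sameOutcome_add_assoc (x y z : ShortGame) :
    SameOutcome (x + y + z) (x + (y + z)) := by
  have hr : IsBisimulation
      (fun a b => ∃ x y z : ShortGame, a = x + y + z ∧ b = x + (y + z)) := by
    constructor <;> rintro _ _ ⟨x, y, z, rfl, rfl⟩ t ht <;>
      simp only [isLeftOption_add, isRightOption_add] at ht ⊢ <;> grind
  exact hr.sameOutcome ⟨x, y, z, rfl, rfl⟩

namespace MisereEq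

theorem refl (G : ShortGame) : MisereEq G G := fun _ _ => Iff.rfl

theorem symm {G H : ShortGame} (h : MisereEq G H) : MisereEq H G := fun X => (h X).symm

theorem trans {G H K : ShortGame} (h : MisereEq G H) (h' : MisereEq H K) : MisereEq G K :=
  fun X => (h X).trans (h' X)

theorem add_right {G H : ShortGame} (h : MisereEq G H) (K : ShortGame) :
    MisereEq (G + K) (H + K) := fun X =>
  (sameOutcome_add_assoc G K X).trans ((h (K + X)).trans (sameOutcome_add_assoc H K X).symm)

theorem add_comm (G H : ShortGame) : MisereEq (G + H) (H + G) := by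
  have hr : IsBisimulation
      (fun a b => ∃ x y z : ShortGame, a = x + y + z ∧ b = y + x + z) := by
    constructor <;> rintro _ _ ⟨x, y, z, rfl, rfl⟩ t ht <;>
      simp only [isLeftOption_add, isRightOption_add] at ht ⊢ <;> grind
  exact fun X => hr.sameOutcome ⟨G, H, X, rfl, rfl⟩

theorem add {G G' H H' : ShortGame} (hG : MisereEq G G') (hH : MisereEq H H') :
    MisereEq (G + H) (G' + H') :=
  (hG.add_right H).trans
    ((add_comm G' H).trans ((hH.add_right G').trans (add_comm H' G')))

theorem add_assoc (G H K : ShortGame) : MisereEq (G + H + K) (G + (H + K)) := by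
  have hr : IsBisimulation
      (fun a b => ∃ x y z w : ShortGame, a = x + y + z + w ∧ b = x + (y + z) + w) := by
    constructor <;> rintro _ _ ⟨x, y, z, w, rfl, rfl⟩ t ht <;>
      simp only [isLeftOption_add, isRightOption_add] at ht ⊢ <;> grind
  exact fun X => hr.sameOutcome ⟨G, H, K, X, rfl, rfl⟩

theorem zero_add (G : ShortGame) : MisereEq (0 + G) G := by
  have hr : IsBisimulation
      (fun a b => ∃ x y : ShortGame, a = 0 + x + y ∧ b = x + y) := by
    constructor <;> rintro _ _ ⟨x, y, rfl, rfl⟩ t ht <;>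
      simp only [isLeftOption_add, isRightOption_add] at ht ⊢ <;>
      grind [not_isLeftOption_zero, not_isRightOption_zero]
  exact fun X => hr.sameOutcome ⟨G, X, rfl, rfl⟩

end MisereEq

theorem isSubposition_add {z w : ShortGame} (h : IsSubposition z w) :
    ∀ x y : ShortGame, w = x + y →
      ∃ x' y', IsSubposition x' x ∧ IsSubposition y' y ∧ z = x' + y' := by
  induction h using Relation.ReflTransGen.head_induction_on with
  | refl => exact fun x y h => ⟨x, y, .refl, .refl, h⟩
  | head hac _ ih =>
    intro x y hw
    obtain ⟨x', y', hx, hy, rfl⟩ := ih x y hw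
    rcases hac with hac | hac
    · rcases isLeftOption_add.1 hac with ⟨x'', h, rfl⟩ | ⟨y'', h, rfl⟩
      · exact ⟨x'', y', .head (Or.inl h) hx, hy, rfl⟩
      · exact ⟨x', y'', hx, .head (Or.inl h) hy, rfl⟩
    · rcases isRightOption_add.1 hac with ⟨x'', h, rfl⟩ | ⟨y'', h, rfl⟩
      · exact ⟨x'', y', .head (Or.inr h) hx, hy, rfl⟩
      · exact ⟨x', y'', hx, .head (Or.inr h) hy, rfl⟩

theorem IsLeftDeadEnd.add {x y : ShortGame} (hx : IsLeftDeadEnd x) (hy : IsLeftDeadEnd y) :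
    IsLeftDeadEnd (x + y) := by
  intro z hz t ht
  obtain ⟨x', y', hx', hy', rfl⟩ := isSubposition_add hz x y rfl
  rcases isLeftOption_add.1 ht with ⟨s, hs, -⟩ | ⟨s, hs, -⟩
  · exact hx x' hx' s hs
  · exact hy y' hy' s hs

theorem isLeftDeadEnd_zero : IsLeftDeadEnd 0 := by
  intro x hx
  have : x = 0 := by
    induction hx using Relation.ReflTransGen.head_induction_on with
    | refl => rfl
    | head hac _ ih =>
      subst ih
      rcases hac with h | h
      · exact absurd h (not_isLeftOption_zero _)
      · exact absurd h (not_isRightOption_zero _)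
  rw [this]
  exact not_isLeftOption_zero

end ShortGame

/-- Left dead ends, up to equality modulo the full misère universe. -/
def leftDeadEndSetoid : Setoid {G : ShortGame // G.IsLeftDeadEnd} where
  r G H := ShortGame.MisereEq G.1 H.1
  iseqv := ⟨fun G => .refl G.1, fun h => h.symm, fun h h' => h.trans h'⟩

/-- The monoid `ℒ` of Left dead ends: its elements are the Left dead ends modulo equality (in the
full misère universe), its operation is the disjunctive sum. -/
def LeftDeadEndMonoid : Type := Quotient leftDeadEndSetoid

namespace LeftDeadEndMonoid

/-- The class of a Left dead end. -/
def mk (G : ShortGame) (hG : G.IsLeftDeadEnd) : LeftDeadEndMonoid :=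
  Quotient.mk leftDeadEndSetoid ⟨G, hG⟩

theorem mk_eq_mk {G H : ShortGame} (hG : G.IsLeftDeadEnd) (hH : H.IsLeftDeadEnd) :
    mk G hG = mk H hH ↔ G.MisereEq H :=
  Quotient.eq (r := leftDeadEndSetoid)

instance : Zero LeftDeadEndMonoid := ⟨mk 0 ShortGame.isLeftDeadEnd_zero⟩

noncomputable instance : Add LeftDeadEndMonoid :=
  ⟨Quotient.map₂ (fun G H => ⟨G.1 + H.1, G.2.add H.2⟩) (fun _ _ h _ _ h' => h.add h')⟩

theorem mk_add_mk {G H : ShortGame} (hG : G.IsLeftDeadEnd) (hH : H.IsLeftDeadEnd) :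
    mk G hG + mk H hH = mk (G + H) (hG.add hH) := rfl

noncomputable instance : AddCommMonoid LeftDeadEndMonoid where
  add_assoc := by
    rintro ⟨G⟩ ⟨H⟩ ⟨K⟩
    exact Quotient.sound (ShortGame.MisereEq.add_assoc G.1 H.1 K.1)
  add_comm := by
    rintro ⟨G⟩ ⟨H⟩
    exact Quotient.sound (ShortGame.MisereEq.add_comm G.1 H.1)
  zero_add := by
    rintro ⟨G⟩
    exact Quotient.sound (ShortGame.MisereEq.zero_add G.1)
  add_zero := by
    rintro ⟨G⟩
    exact Quotient.sound ((ShortGame.MisereEq.add_comm G.1 0).trans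
      (ShortGame.MisereEq.zero_add G.1))
  nsmul := nsmulRec

end LeftDeadEndMonoid

namespace ShortGame

/-! Order Left dead ends by `H ≤ G` when Right, moving first, wins `H + X` whenever Right wins `G +
X`. Test games show that this order alone determines equality, and that it is recursive
(`IsLeftDeadEnd.rightFirstGe_iff`): `H ≤ G` iff `H` is a Right end whenever `G` is, and each Right
option of `G` lies above some Right option of `H`. The recursion yields cancellation
(`le_of_mk_add_le_mk_add`). For torsion, let `(n+1)G = (n+1)H` and let `M` be a minimal Right option
of `G`. The option `nG + M` lies above some `nH + H'`, which lies above some `nG + K`. Cancellation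
and minimality force `K = M`, so `nG + M = nH + H'`. Multiplying by `n+1` and cancelling leaves
`(n+1)M = (n+1)H'`, so `M = H'` by induction. -/

theorem wellFounded_isOption : WellFounded IsOption := by
  refine ⟨fun G => ?_⟩
  induction G with
  | mk m n L R ihL ihR =>
    refine ⟨_, ?_⟩
    rintro _ (⟨i, rfl⟩ | ⟨j, rfl⟩)
    exacts [ihL i, ihR j]

theorem wellFounded_isRightOption : WellFounded IsRightOption :=
  Subrelation.wf (fun h => Or.inr h) wellFounded_isOption

/-! ### Ends, and moves in sums -/

/-- A Right end is a game with no Right option. -/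
def IsRightEnd (G : ShortGame) : Prop := ∀ x, ¬ IsRightOption x G

theorem isRightEnd_add {x y : ShortGame} :
    IsRightEnd (x + y) ↔ IsRightEnd x ∧ IsRightEnd y := by
  simp only [IsRightEnd, isRightOption_add]
  grind

theorem isLeftEnd_add {x y : ShortGame} :
    IsLeftEnd (x + y) ↔ IsLeftEnd x ∧ IsLeftEnd y := by
  simp only [IsLeftEnd, isLeftOption_add]
  grind

theorem isLeftEnd_zero : IsLeftEnd 0 := not_isLeftOption_zero

theorem IsLeftDeadEnd.isLeftEnd {G : ShortGame} (hG : IsLeftDeadEnd G) : IsLeftEnd G :=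
  hG G .refl

theorem IsLeftDeadEnd.of_isRightOption {G x : ShortGame} (hG : IsLeftDeadEnd G)
    (hx : IsRightOption x G) : IsLeftDeadEnd x :=
  fun y hy => hG y (hy.trans (.single (Or.inr hx)))

theorem misereWinsFirst_right_add_iff (G X : ShortGame) :
    MisereWinsFirst .right (G + X) ↔ (IsRightEnd G ∧ IsRightEnd X) ∨
      (∃ G', IsRightOption G' G ∧ ¬ MisereWinsFirst .left (G' + X)) ∨
      ∃ X', IsRightOption X' X ∧ ¬ MisereWinsFirst .left (G + X') := by
  rw [misereWinsFirst_right_iff, ← isRightEnd_add]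
  refine or_congr Iff.rfl ?_
  simp only [isRightOption_add]
  grind

theorem IsLeftEnd.misereWinsFirst_left_add_iff {G : ShortGame} (hG : IsLeftEnd G)
    (X : ShortGame) :
    MisereWinsFirst .left (G + X) ↔
      IsLeftEnd X ∨ ∃ X', IsLeftOption X' X ∧ ¬ MisereWinsFirst .right (G + X') := by
  rw [misereWinsFirst_left_iff]
  refine or_congr (isLeftEnd_add.trans (and_iff_right hG)) ?_
  simp only [isLeftOption_add]
  have := hG
  simp only [IsLeftEnd] at this
  grind

/-! ### Comparison with Right moving first -/

/-- `RightFirstGe G H`: whatever game is added, if Right wins moving first with `G` then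
Right wins moving first with `H`. -/
def RightFirstGe (G H : ShortGame) : Prop :=
  ∀ X, MisereWinsFirst .right (G + X) → MisereWinsFirst .right (H + X)

namespace RightFirstGe

theorem refl (G : ShortGame) : RightFirstGe G G := fun _ => id

theorem trans {G H K : ShortGame} (h : RightFirstGe G H) (h' : RightFirstGe H K) :
    RightFirstGe G K := fun X hX => h' X (h X hX)

theorem add_right {G H : ShortGame} (h : RightFirstGe G H) (K : ShortGame) :
    RightFirstGe (G + K) (H + K) := fun X hX =>
  (sameOutcome_add_assoc H K X _).2 (h _ ((sameOutcome_add_assoc G K X _).1 hX))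

/-- The game `{{|0}|X}` turns a question about Left moving first into one about Right. -/
theorem misereWinsFirst_left {G H : ShortGame} (h : RightFirstGe G H) (hH : IsLeftDeadEnd H)
    (X : ShortGame) (hX : MisereWinsFirst .left (H + X)) : MisereWinsFirst .left (G + X) := by
  by_contra hG
  have h1 := h (mk 1 1 (fun _ => mk 0 1 Fin.elim0 fun _ => 0) fun _ => X)
    ((misereWinsFirst_right_add_iff _ _).2 (Or.inr (Or.inr ⟨X, ⟨0, rfl⟩, hG⟩)))
  -- Right must move to `X` at once: after a move to `H'`, Left plays to `{|0}`, and any Right move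
  -- then leaves Left without a move, which wins for Left.
  rcases (misereWinsFirst_right_add_iff _ _).1 h1 with ⟨-, h2⟩ | ⟨H', hH', h2⟩ | ⟨_, ⟨_, rfl⟩, h2⟩
  · exact h2 X ⟨0, rfl⟩
  · have hd := hH.of_isRightOption hH'
    refine h2 ((hd.isLeftEnd.misereWinsFirst_left_add_iff _).2 (Or.inr ⟨_, ⟨0, rfl⟩, fun h3 => ?_⟩))
    have hend : IsLeftEnd (mk 0 1 Fin.elim0 fun _ => 0) := fun _ ⟨i, _⟩ => i.elim0
    rcases (misereWinsFirst_right_add_iff _ _).1 h3 with ⟨-, h4⟩ | ⟨H'', hH'', h4⟩ | ⟨_, ⟨_, rfl⟩, h4⟩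
    · exact h4 0 ⟨0, rfl⟩
    · exact h4 (((hd.of_isRightOption hH'').isLeftEnd.misereWinsFirst_left_add_iff _).2
        (Or.inl hend))
    · exact h4 ((hd.isLeftEnd.misereWinsFirst_left_add_iff _).2 (Or.inl isLeftEnd_zero))
  · exact h2 hX

theorem misereEq {G H : ShortGame} (hG : IsLeftDeadEnd G) (hH : IsLeftDeadEnd H)
    (h : RightFirstGe G H) (h' : RightFirstGe H G) : MisereEq G H := by
  rintro X (_ | _)
  · exact ⟨h'.misereWinsFirst_left hG X, h.misereWinsFirst_left hH X⟩
  · exact ⟨h X, h' X⟩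

end RightFirstGe

theorem MisereEq.rightFirstGe {G H : ShortGame} (h : MisereEq G H) : RightFirstGe G H :=
  fun X => (h X .right).1

/-! ### Recursive description of the comparison -/

/-- The game in which Left has exactly `n` consecutive moves and Right has none. -/
def leftInteger : ℕ → ShortGame
  | 0 => 0
  | n + 1 => mk 1 0 (fun _ => leftInteger n) Fin.elim0

/-- Right runs `G` down to a Right end while Left still has moves to spend. -/
theorem IsLeftDeadEnd.exists_misereWinsFirst_right_add_leftInteger {G : ShortGame}
    (hG : IsLeftDeadEnd G) :
    ∃ N, ∀ n, N ≤ n → MisereWinsFirst .right (G + leftInteger n) := by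
  induction G using wellFounded_isRightOption.induction with
  | _ G ih =>
    by_cases he : IsRightEnd G
    · refine ⟨1, fun n hn => (misereWinsFirst_right_add_iff _ _).2 (Or.inl ⟨he, ?_⟩)⟩
      obtain ⟨k, rfl⟩ := Nat.exists_eq_add_of_le' hn
      exact fun _ ⟨i, _⟩ => i.elim0
    · simp only [IsRightEnd, not_forall, not_not] at he
      obtain ⟨G', hG'⟩ := he
      have hd := hG.of_isRightOption hG'
      obtain ⟨N, hN⟩ := ih G' hG' hd
      refine ⟨N + 1, fun n hn =>
        (misereWinsFirst_right_add_iff _ _).2 (Or.inr (Or.inl ⟨G', hG', ?_⟩))⟩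
      obtain ⟨k, rfl⟩ := Nat.exists_eq_add_of_le' ((Nat.le_add_left 1 N).trans hn)
      rw [hd.isLeftEnd.misereWinsFirst_left_add_iff]
      rintro (h | ⟨_, ⟨_, rfl⟩, h⟩)
      · exact h _ ⟨0, rfl⟩
      · exact h (hN k (by omega))

theorem IsLeftDeadEnd.rightFirstGe_iff {G H : ShortGame} (hG : IsLeftDeadEnd G)
    (hH : IsLeftDeadEnd H) :
    RightFirstGe G H ↔ (IsRightEnd G → IsRightEnd H) ∧
      ∀ G', IsRightOption G' G → ∃ H', IsRightOption H' H ∧ RightFirstGe G' H' := by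
  refine ⟨fun h => ⟨fun he => ?_, fun G' hG' => ?_⟩, fun ⟨he, ho⟩ X => ?_⟩
  · have h0 : IsRightEnd 0 := not_isRightOption_zero
    rcases (misereWinsFirst_right_add_iff _ _).1
      (h 0 ((misereWinsFirst_right_add_iff _ _).2 (Or.inl ⟨he, h0⟩))) with
      h1 | ⟨H', hH', h1⟩ | ⟨_, h1, -⟩
    · exact h1.1
    · exact absurd (((hH.of_isRightOption hH').isLeftEnd.misereWinsFirst_left_add_iff _).2
        (Or.inl isLeftEnd_zero)) h1
    · exact absurd h1 (h0 _)
  · by_contra! hno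
    have hGd := hG.of_isRightOption hG'
    obtain ⟨m, n, L, R⟩ := H
    have hsep : ∀ j, ∃ X, MisereWinsFirst .right (G' + X) ∧
        ¬ MisereWinsFirst .right (R j + X) := fun j => by
      simpa [RightFirstGe] using hno (R j) ⟨j, rfl⟩
    choose X hX1 hX2 using hsep
    obtain ⟨N, hN⟩ := hGd.exists_misereWinsFirst_right_add_leftInteger
    -- Left's options `X j` refute each Right option `R j` of `H`, yet none helps against `G'`. The
    -- option `leftInteger N` keeps Left from being out of moves when `H` is a Right end. The Right
    -- option `0` makes the test game no Right end, and taking it loses.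
    have h1 := h (mk (n + 1) 1 (Fin.cons (leftInteger N) X) fun _ => 0) <| by
      refine (misereWinsFirst_right_add_iff _ _).2 (Or.inr (Or.inl ⟨G', hG', ?_⟩))
      rw [hGd.isLeftEnd.misereWinsFirst_left_add_iff]
      rintro (h | ⟨_, ⟨i, rfl⟩, h⟩)
      · exact h _ ⟨0, rfl⟩
      · induction i using Fin.cases with
        | zero => exact h (hN N le_rfl)
        | succ j => exact h (hX1 j)
    rcases (misereWinsFirst_right_add_iff _ _).1 h1 with
      ⟨-, h2⟩ | ⟨_, ⟨j, rfl⟩, h2⟩ | ⟨_, ⟨_, rfl⟩, h2⟩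
    · exact h2 0 ⟨0, rfl⟩
    · exact h2 (((hH.of_isRightOption ⟨j, rfl⟩).isLeftEnd.misereWinsFirst_left_add_iff _).2
        (Or.inr ⟨X j, ⟨j.succ, by simp⟩, hX2 j⟩))
    · exact h2 ((hH.isLeftEnd.misereWinsFirst_left_add_iff _).2 (Or.inl isLeftEnd_zero))
  -- Moves in `X` swap the player to move, so both starting players go into one induction.
  · suffices ∀ X, (MisereWinsFirst .right (G + X) → MisereWinsFirst .right (H + X)) ∧
        (MisereWinsFirst .left (H + X) → MisereWinsFirst .left (G + X)) from (this X).1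
    intro X
    induction X using wellFounded_isOption.induction with
    | _ X ih =>
      constructor
      · simp only [misereWinsFirst_right_add_iff]
        rintro (h | ⟨G', hG', h⟩ | ⟨X', hX', h⟩)
        · exact Or.inl ⟨he h.1, h.2⟩
        · obtain ⟨H', hH', hge⟩ := ho G' hG'
          exact Or.inr (Or.inl ⟨H', hH', fun hw =>
            h (hge.misereWinsFirst_left (hH.of_isRightOption hH') X hw)⟩)
        · exact Or.inr (Or.inr ⟨X', hX', fun hw => h ((ih X' (Or.inr hX')).2 hw)⟩)
      · rw [hG.isLeftEnd.misereWinsFirst_left_add_iff, hH.isLeftEnd.misereWinsFirst_left_add_iff]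
        rintro (h | ⟨X', hX', h⟩)
        · exact Or.inl h
        · exact Or.inr ⟨X', hX', fun hw => h ((ih X' (Or.inl hX')).1 hw)⟩

/-! ### Lengths of Right's runs, and copies -/

/-- Right can bring the game to a Right end in exactly `n` consecutive moves. -/
def EndsIn : ℕ → ShortGame → Prop
  | 0, G => IsRightEnd G
  | n + 1, G => ∃ G', IsRightOption G' G ∧ EndsIn n G'

theorem exists_endsIn (G : ShortGame) : ∃ n, EndsIn n G := by
  induction G using wellFounded_isRightOption.induction with
  | _ G ih =>
    by_cases he : IsRightEnd G
    · exact ⟨0, he⟩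
    · simp only [IsRightEnd, not_forall, not_not] at he
      obtain ⟨G', hG'⟩ := he
      obtain ⟨n, hn⟩ := ih G' hG'
      exact ⟨n + 1, G', hG', hn⟩

theorem EndsIn.of_add {n : ℕ} {G H : ShortGame} (h : EndsIn n (G + H)) :
    ∃ i j, i + j = n ∧ EndsIn i G ∧ EndsIn j H := by
  induction n generalizing G H with
  | zero => exact ⟨0, 0, rfl, isRightEnd_add.1 h⟩
  | succ n ih =>
    obtain ⟨K, hK, hn⟩ := h
    rcases isRightOption_add.1 hK with ⟨G', hG', rfl⟩ | ⟨H', hH', rfl⟩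
    · obtain ⟨i, j, rfl, hi, hj⟩ := ih hn
      exact ⟨i + 1, j, by omega, ⟨G', hG', hi⟩, hj⟩
    · obtain ⟨i, j, rfl, hi, hj⟩ := ih hn
      exact ⟨i, j + 1, by omega, hi, ⟨H', hH', hj⟩⟩

theorem IsLeftDeadEnd.copies {G : ShortGame} (hG : G.IsLeftDeadEnd) (n : ℕ) :
    (copies n G).IsLeftDeadEnd := by
  induction n with
  | zero => exact isLeftDeadEnd_zero
  | succ n ih => exact ih.add hG

theorem isRightEnd_copies_succ {G : ShortGame} {n : ℕ} :
    IsRightEnd (copies (n + 1) G) ↔ IsRightEnd G := by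
  refine ⟨fun h => (isRightEnd_add.1 h).2, fun h => ?_⟩
  induction n with
  | zero => exact isRightEnd_add.2 ⟨not_isRightOption_zero, h⟩
  | succ n ih => exact isRightEnd_add.2 ⟨ih, h⟩

end ShortGame

/-! ### The ordered monoid -/

namespace LeftDeadEndMonoid

open ShortGame

theorem ind {P : LeftDeadEndMonoid → Prop} (h : ∀ G hG, P (mk G hG)) (a : LeftDeadEndMonoid) :
    P a := by
  obtain ⟨G, hG⟩ := a
  exact h G hG

/-- Smaller means better for Right, so the arguments of `RightFirstGe` are reversed. -/
instance : LE LeftDeadEndMonoid :=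
  ⟨Quotient.lift₂ (fun H G => RightFirstGe G.1 H.1) fun _ _ _ _ hH hG =>
    propext ⟨fun h => hG.symm.rightFirstGe.trans (h.trans hH.rightFirstGe),
      fun h => hG.rightFirstGe.trans (h.trans hH.symm.rightFirstGe)⟩⟩

theorem mk_le_mk {G H : ShortGame} (hG : G.IsLeftDeadEnd) (hH : H.IsLeftDeadEnd) :
    mk H hH ≤ mk G hG ↔ RightFirstGe G H := Iff.rfl

instance : PartialOrder LeftDeadEndMonoid where
  le_refl := ind fun G _ => RightFirstGe.refl G
  le_trans a b c := by
    induction a using ind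
    induction b using ind
    induction c using ind
    exact fun h h' => RightFirstGe.trans h' h
  le_antisymm a b := by
    induction a using ind with | _ G hG
    induction b using ind with | _ H hH
    exact fun h h' => (mk_eq_mk _ _).2 (RightFirstGe.misereEq hG hH h' h)

instance : IsOrderedAddMonoid LeftDeadEndMonoid where
  add_le_add_left a b h c := by
    induction a using ind
    induction b using ind
    induction c using ind
    exact RightFirstGe.add_right h _

theorem mk_le_mk_iff {G H : ShortGame} (hG : G.IsLeftDeadEnd) (hH : H.IsLeftDeadEnd) :
    mk H hH ≤ mk G hG ↔ (IsRightEnd G → IsRightEnd H) ∧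
      ∀ G' (hG' : IsRightOption G' G), ∃ H', ∃ hH' : IsRightOption H' H,
        mk H' (hH.of_isRightOption hH') ≤ mk G' (hG.of_isRightOption hG') := by
  rw [mk_le_mk, hG.rightFirstGe_iff hH]
  simp only [mk_le_mk, exists_prop]

/-! ### Cancellation -/

theorem endsIn_of_le {n : ℕ} {G H : ShortGame} {hG : G.IsLeftDeadEnd} {hH : H.IsLeftDeadEnd}
    (hn : EndsIn n G) (h : mk H hH ≤ mk G hG) : EndsIn n H := by
  induction n generalizing G H with
  | zero => exact ((mk_le_mk_iff hG hH).1 h).1 hn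
  | succ n ih =>
    obtain ⟨G', hG', hn⟩ := hn
    obtain ⟨H', hH', h'⟩ := ((mk_le_mk_iff hG hH).1 h).2 G' hG'
    exact ⟨H', hH', ih hn h'⟩

/-- A shortest run of `X` to a Right end is matched by an equally long run of `H + X`; its share in
`X` is already that long, so none of it is spent in `H`. -/
theorem isRightEnd_of_mk_add_le {H X : ShortGame} (hH : H.IsLeftDeadEnd) (hX : X.IsLeftDeadEnd)
    (h : mk H hH + mk X hX ≤ mk X hX) : IsRightEnd H := by
  classical
  obtain ⟨i, j, hij, hi, hj⟩ :=
    (endsIn_of_le (hG := hX) (hH := hH.add hX) (Nat.find_spec (exists_endsIn X)) h).of_add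
  have := Nat.find_min' (exists_endsIn X) hj
  obtain rfl : i = 0 := by omega
  exact hi

theorem eq_zero_of_isRightEnd {G : ShortGame} (hG : G.IsLeftDeadEnd) (he : IsRightEnd G) :
    mk G hG = 0 :=
  le_antisymm
    ((mk_le_mk_iff isLeftDeadEnd_zero hG).2
      ⟨fun _ => he, fun _ h => absurd h (not_isRightOption_zero _)⟩)
    ((mk_le_mk_iff hG isLeftDeadEnd_zero).2
      ⟨fun _ => not_isRightOption_zero, fun _ h => absurd h (he _)⟩)

/-- Keep moving in the copy of `X` on the larger side. Each answer in the other copy gives the same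
situation with a smaller `X`, so eventually some answer is made in `H`, and `ih` cancels. -/
theorem exists_le_of_mk_add_le_mk_add {G H X X' : ShortGame} (hG : G.IsLeftDeadEnd)
    (hH : H.IsLeftDeadEnd) (hX : X.IsLeftDeadEnd) (hX' : IsRightOption X' X)
    (ih : ∀ H hH X hX, mk H hH + mk X hX ≤ mk G hG + mk X hX → mk H hH ≤ mk G hG)
    (h : mk H hH + mk X' (hX.of_isRightOption hX') ≤ mk G hG + mk X hX) :
    ∃ H', ∃ hH' : IsRightOption H' H, mk H' (hH.of_isRightOption hH') ≤ mk G hG := by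
  induction X using wellFounded_isRightOption.induction generalizing X' with
  | _ X ihX =>
    have hXd := hX.of_isRightOption hX'
    obtain ⟨K, hK, hle⟩ := ((mk_le_mk_iff (hG.add hX) (hH.add hXd)).1 h).2 (G + X')
      (isRightOption_add.2 (Or.inr ⟨X', hX', rfl⟩))
    rcases isRightOption_add.1 hK with ⟨H', hH', rfl⟩ | ⟨X'', hX'', rfl⟩
    · exact ⟨H', hH', ih _ _ X' hXd hle⟩
    · exact ihX X' hX' hXd hX'' hle

theorem le_of_mk_add_le_mk_add {G H X : ShortGame} (hG : G.IsLeftDeadEnd) (hH : H.IsLeftDeadEnd)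
    (hX : X.IsLeftDeadEnd) (h : mk H hH + mk X hX ≤ mk G hG + mk X hX) :
    mk H hH ≤ mk G hG := by
  induction G using wellFounded_isRightOption.induction generalizing H X with
  | _ G ih =>
    refine (mk_le_mk_iff hG hH).2 ⟨fun he => ?_, fun G' hG' => ?_⟩
    · rw [eq_zero_of_isRightEnd hG he, zero_add] at h
      exact isRightEnd_of_mk_add_le hH hX h
    · have hGd := hG.of_isRightOption hG'
      obtain ⟨K, hK, hle⟩ := ((mk_le_mk_iff (hG.add hX) (hH.add hX)).1 h).2 (G' + X)
        (isRightOption_add.2 (Or.inl ⟨G', hG', rfl⟩))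
      rcases isRightOption_add.1 hK with ⟨H', hH', rfl⟩ | ⟨X', hX', rfl⟩
      · exact ⟨H', hH', ih G' hG' hGd _ hX hle⟩
      · exact exists_le_of_mk_add_le_mk_add hGd hH hX hX'
          (fun _ hH _ hX => ih G' hG' hGd hH hX) hle

instance : IsOrderedCancelAddMonoid LeftDeadEndMonoid :=
  { le_of_add_le_add_left := fun a b c h => by
      rw [add_comm a b, add_comm a c] at h
      induction a using ind
      induction b using ind
      induction c using ind
      exact le_of_mk_add_le_mk_add _ _ _ h }

/-! ### Multiples and torsion -/

theorem mk_copies {G : ShortGame} (hG : G.IsLeftDeadEnd) (n : ℕ) :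
    mk (copies n G) (hG.copies n) = n • mk G hG := by
  induction n with
  | zero => rw [zero_nsmul]; rfl
  | succ n ih => rw [succ_nsmul, ← ih]; rfl

theorem exists_of_isRightOption_copies_succ {G K : ShortGame} (hG : G.IsLeftDeadEnd) {n : ℕ}
    (hK : IsRightOption K (copies (n + 1) G)) :
    ∃ G', ∃ hG' : IsRightOption G' G, mk K ((hG.copies _).of_isRightOption hK) =
      n • mk G hG + mk G' (hG.of_isRightOption hG') := by
  induction n generalizing K with
  | zero =>
    rcases isRightOption_add.1 hK with ⟨K', hK', rfl⟩ | ⟨G', hG', rfl⟩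
    · exact absurd hK' (not_isRightOption_zero _)
    · exact ⟨G', hG', by rw [zero_nsmul]; rfl⟩
  | succ n ih =>
    rcases isRightOption_add.1 hK with ⟨K', hK', rfl⟩ | ⟨G', hG', rfl⟩
    · obtain ⟨G', hG', h⟩ := ih hK'
      refine ⟨G', hG', (congrArg (· + mk G hG) h).trans ?_⟩
      rw [succ_nsmul, add_right_comm (n • mk G hG) (mk G hG)]
    · exact ⟨G', hG', by rw [← mk_copies]; rfl⟩

theorem exists_le_of_succ_nsmul_le {G H : ShortGame} (hG : G.IsLeftDeadEnd)
    (hH : H.IsLeftDeadEnd) {n : ℕ} (h : (n + 1) • mk H hH ≤ (n + 1) • mk G hG) {G' : ShortGame}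
    (hG' : IsRightOption G' G) :
    ∃ H', ∃ hH' : IsRightOption H' H, n • mk H hH + mk H' (hH.of_isRightOption hH') ≤
      n • mk G hG + mk G' (hG.of_isRightOption hG') := by
  rw [← mk_copies, ← mk_copies] at h
  obtain ⟨K, hK, hle⟩ := ((mk_le_mk_iff _ _).1 h).2 (copies n G + G')
    (isRightOption_add.2 (Or.inr ⟨G', hG', rfl⟩))
  obtain ⟨H', hH', hKH⟩ := exists_of_isRightOption_copies_succ hH hK
  refine ⟨H', hH', ?_⟩
  rwa [← hKH, ← mk_copies]

theorem exists_minimal_isRightOption_le {G G' : ShortGame} (hG : G.IsLeftDeadEnd)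
    (hG' : IsRightOption G' G) :
    ∃ M, ∃ hM : IsRightOption M G,
      mk M (hG.of_isRightOption hM) ≤ mk G' (hG.of_isRightOption hG') ∧
      ∀ K, ∀ hK : IsRightOption K G,
        mk K (hG.of_isRightOption hK) ≤ mk M (hG.of_isRightOption hM) →
        mk K (hG.of_isRightOption hK) = mk M (hG.of_isRightOption hM) := by
  obtain ⟨m, n, L, R⟩ := G
  obtain ⟨j, rfl⟩ := hG'
  obtain ⟨_, hle, ⟨i, rfl⟩, hmin⟩ := (Set.finite_range fun j => mk (R j)
    (hG.of_isRightOption ⟨j, rfl⟩)).exists_le_minimal ⟨j, rfl⟩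
  refine ⟨R i, ⟨i, rfl⟩, hle, ?_⟩
  rintro _ ⟨k, rfl⟩ h
  exact le_antisymm h (hmin ⟨k, rfl⟩ h)

theorem mk_le_mk_of_succ_nsmul_eq {G H : ShortGame} (hG : G.IsLeftDeadEnd)
    (hH : H.IsLeftDeadEnd) {n : ℕ} (h : (n + 1) • mk G hG = (n + 1) • mk H hH)
    (ih : ∀ G' H' (hG' : IsRightOption G' G) (hH' : IsRightOption H' H),
      (n + 1) • mk G' (hG.of_isRightOption hG') = (n + 1) • mk H' (hH.of_isRightOption hH') →
      mk G' (hG.of_isRightOption hG') = mk H' (hH.of_isRightOption hH')) :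
    mk H hH ≤ mk G hG := by
  refine (mk_le_mk_iff hG hH).2 ⟨fun he => ?_, fun G' hG' => ?_⟩
  · rw [← mk_copies, ← mk_copies] at h
    exact isRightEnd_copies_succ.1
      (((mk_le_mk_iff _ _).1 h.ge).1 (isRightEnd_copies_succ.2 he))
  · obtain ⟨M, hM, hle, hmin⟩ := exists_minimal_isRightOption_le hG hG'
    obtain ⟨H', hH', h1⟩ := exists_le_of_succ_nsmul_le hG hH h.ge hM
    obtain ⟨K, hK, h2⟩ := exists_le_of_succ_nsmul_le hH hG h.le hH'
    -- Cancelling `n • mk G hG` gives `K ≤ M`, hence `K = M`; the two inequalities become an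
    -- equality.
    rw [hmin K hK (le_of_add_le_add_left (h2.trans h1))] at h2
    -- The factor `n + 1` turns the unequal-looking `nG` and `nH` into the equal `n(n+1)G` and
    -- `n(n+1)H`.
    have h3 := congrArg ((n + 1) • ·) (le_antisymm h1 h2)
    simp only [nsmul_add] at h3
    rw [nsmul_left_comm, nsmul_left_comm (mk G hG), h] at h3
    exact ⟨H', hH', (ih M H' hM hH' (add_left_cancel h3).symm).ge.trans hle⟩

theorem mk_eq_mk_of_succ_nsmul_eq {G H : ShortGame} (hG : G.IsLeftDeadEnd)
    (hH : H.IsLeftDeadEnd) {n : ℕ} (h : (n + 1) • mk G hG = (n + 1) • mk H hH) :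
    mk G hG = mk H hH := by
  induction G using wellFounded_isRightOption.induction generalizing H with
  | _ G ih =>
    exact le_antisymm
      (mk_le_mk_of_succ_nsmul_eq hH hG h.symm fun _ G' hH' hG' h' =>
        (ih G' hG' (hG.of_isRightOption hG') (hH.of_isRightOption hH') h'.symm).symm)
      (mk_le_mk_of_succ_nsmul_eq hG hH h fun G' _ hG' hH' h' =>
        ih G' hG' (hG.of_isRightOption hG') (hH.of_isRightOption hH') h')

instance : IsAddTorsionFree LeftDeadEndMonoid where
  nsmul_right_injective n hn a b h := by
    induction a using ind
    induction b using ind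
    obtain ⟨n, rfl⟩ := Nat.exists_eq_succ_of_ne_zero hn
    exact mk_eq_mk_of_succ_nsmul_eq _ _ h

end LeftDeadEndMonoid

theorem mainTheorem12 :
    (∀ G H : ShortGame, G.IsLeftDeadEnd → H.IsLeftDeadEnd → ∀ n : ℕ, 0 < n →
      ShortGame.MisereEq (ShortGame.copies n G) (ShortGame.copies n H) →
      ShortGame.MisereEq G H) ∧
    IsAddTorsionFree (Algebra.GrothendieckAddGroup LeftDeadEndMonoid) := by
  -- In the group of differences of a cancellative monoid, `n(a - b) = 0` says `na = nb`, so
  -- torsion-freeness carries over.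
  refine ⟨fun G H hG hH n hn h => ?_, inferInstance⟩
  rw [← LeftDeadEndMonoid.mk_eq_mk (hG.copies n) (hH.copies n), LeftDeadEndMonoid.mk_copies hG,
    LeftDeadEndMonoid.mk_copies hH] at h
  exact (LeftDeadEndMonoid.mk_eq_mk hG hH).1 (nsmul_right_injective hn.ne' h)
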